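/- Let $d\ge 1$, $1<p<\infty$, $1\le i\le d$, and let $\Omega\subset\mathbb R^d$ be a bounded domain (nonempty, open, connected) whose boundary is the disjoint union of two sets $\partial\Omega_D$ and $\partial\Omega_N=\partial\Omega\setminus\partial\Omega_D$, each of positive $(d-1)$-dimensional Hausdorff measure $\mathcal H^{d-1}$. Suppose that $\Omega$ is regular along $\partial\Omega_N$: near every point of $\partial\Omega_N$, in suitable Cartesian coordinates, $\Omega$ is the region below the graph of a continuous function, and near $\mathcal H^{d-1}$-almost every point of $\partial\Omega_N$ the boundary is $C^1$ with $\Omega$ on one side of it, so that the outward unit normal $\nu$ is defined there. For a bounded domain $U$ in a Euclidean space with $\partial U_D\subseteq\partial U$, define the fundamental eigenvalue of the $p$-Laplacian with respect to $U,\partial U_D$ by $$\lambda_1(U,\partial U_D,p)=\inf_\zeta \frac{\int_U|\nabla\zeta|^p\,dx}{\int_U|\zeta|^p\,dx},$$ where $\zeta$ runs over the restrictions to $U$ of the real-valued smooth functions with compact support contained in the complement of $\partial U_D$, not identically zero on $U$. Let $\mu_{I,p}=\lambda_1((0,1),\{0\},p)$ be the fundamental eigenvalue of the one-dimensional $p$-Laplacian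 on the unit interval with Dirichlet condition at one end and Neumann condition at the other. Box Bound. Suppose that $\partial\Omega_N$ is the graph, in the direction $e_i$, of a function on a subset of the hyperplane $\{x: x_i=0\}$, that is, $\partial\Omega_N=\{x+g(x)e_i: x\in S\}$ for some $S\subseteq\{x: x_i=0\}$ and some $g:S\to\mathbb R$, and that $\nu\cdot e_i\le 0$ at $\mathcal H^{d-1}$-almost every point of $\partial\Omega_N$. Let $L=\sup\{x_i: x\in\Omega\}-\inf\{x_i: x\in\Omega\}$. Then $$\lambda_1(\Omega,\partial\Omega_D,p)\ \ge\ \frac{\mu_{I,p}}{L^p}.$$ -/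

import Mathlib

open MeasureTheory
open scoped ContDiff

noncomputable section

section Variational

variable {E : Type*} [NormedAddCommGroup E] [InnerProductSpace ℝ E]

/-- `ζ` is a smooth compactly supported function on the complement of the Dirichlet part `D`.
The test functions on `Ω` are the restrictions of these to `Ω`. -/
def IsTestFunction (D : Set E) (ζ : E → ℝ) : Prop :=
  ContDiff ℝ ∞ ζ ∧ HasCompactSupport ζ ∧ tsupport ζ ⊆ Dᶜ

/-- The quotient `(∫_Ω |∇ζ|^p) / (∫_Ω |ζ|^p)`. -/
def rayleighQuotientP [CompleteSpace E] [MeasureSpace E] (p : ℝ) (Ω : Set E) (ζ : E → ℝ) : ℝ :=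
  (∫ x in Ω, ‖gradient ζ x‖ ^ p) / (∫ x in Ω, |ζ x| ^ p)

/-- The fundamental eigenvalue `λ₁(Ω, ∂Ω_D, p)` of the `p`-Laplacian: the infimum of the quotient
over all test functions that do not vanish identically on `Ω`. -/
def fundamentalEigenvalue [CompleteSpace E] [MeasureSpace E] (Ω D : Set E) (p : ℝ) : ℝ :=
  sInf {r : ℝ | ∃ ζ : E → ℝ, IsTestFunction D ζ ∧ (∃ x ∈ Ω, ζ x ≠ 0) ∧
    r = rayleighQuotientP p Ω ζ}

/-- Near the boundary point `y`, the set `Ω` is the part strictly below the graph of a continuous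
function, in a Cartesian coordinate system whose last axis points along the unit vector `u`
(boundary "of class C" at `y`). The point `x - ⟪u, x⟫ u` is the projection of `x` to the
hyperplane orthogonal to `u`. -/
def IsClassCAt (Ω : Set E) (y : E) : Prop :=
  ∃ (u : E) (f : E → ℝ) (U : Set E), ‖u‖ = 1 ∧ Continuous f ∧ IsOpen U ∧ y ∈ U ∧
    Ω ∩ U = {x ∈ U | inner ℝ u x < f (x - inner ℝ u x • u)}

/-- Near the boundary point `y` the boundary of `Ω` is `C¹`, with `Ω` on one side of it, and `ν` is
the outward unit normal at `y`. -/
def IsOutwardUnitNormal [CompleteSpace E] (Ω : Set E) (y ν : E) : Prop :=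
  y ∈ frontier Ω ∧ ‖ν‖ = 1 ∧ ∃ (φ : E → ℝ) (U : Set E), IsOpen U ∧ y ∈ U ∧ ContDiffOn ℝ 1 φ U ∧
    Ω ∩ U = {x ∈ U | φ x < 0} ∧ gradient φ y ≠ 0 ∧ gradient φ y = ‖gradient φ y‖ • ν

end Variational

/-- `Ω` is a regular domain in `ℝ^d` with boundary pieces `∂Ω_D = D` and `∂Ω_N = ∂Ω \ D`: a bounded
domain, with both pieces of positive surface measure, whose boundary is of class C at every point
of `∂Ω_N` and `C¹` at almost every point of `∂Ω_N` for the surface measure.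
No regularity is required on `∂Ω_D`. -/
structure IsRegularDomain {d : ℕ} (Ω D : Set (EuclideanSpace ℝ (Fin d))) : Prop where
  isOpen : IsOpen Ω
  isConnected : IsConnected Ω
  isBounded : Bornology.IsBounded Ω
  subset_frontier : D ⊆ frontier Ω
  dirichlet_pos : 0 < Measure.hausdorffMeasure ((d : ℝ) - 1) D
  neumann_pos : 0 < Measure.hausdorffMeasure ((d : ℝ) - 1) (frontier Ω \ D)
  classC : ∀ y ∈ frontier Ω \ D, IsClassCAt Ω y
  ae_C1 : ∀ᵐ y ∂(Measure.hausdorffMeasure ((d : ℝ) - 1)),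
    y ∈ frontier Ω \ D → ∃ ν, IsOutwardUnitNormal Ω y ν

/-- `N` is the graph of a function on a subset of the hyperplane `{x | x i = 0}`. -/
def IsGraphOverHyperplane {d : ℕ} (i : Fin d) (N : Set (EuclideanSpace ℝ (Fin d))) : Prop :=
  ∃ (S : Set (EuclideanSpace ℝ (Fin d))) (g : EuclideanSpace ℝ (Fin d) → ℝ),
    S ⊆ {x | x i = 0} ∧ N = (fun x => x + g x • EuclideanSpace.single i (1 : ℝ)) '' S

/-- The width `sup {x i : x ∈ Ω} - inf {x i : x ∈ Ω}` of `Ω` in the direction of `e_i`. -/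
def widthAlong {d : ℕ} (i : Fin d) (Ω : Set (EuclideanSpace ℝ (Fin d))) : ℝ :=
  sSup ((fun x => x i) '' Ω) - sInf ((fun x => x i) '' Ω)

/-- The fundamental eigenvalue `μ_{I,p}` of the one-dimensional `p`-Laplacian on the unit interval,
Dirichlet at the end `0` and Neumann (no condition on the test functions) at the end `1`. -/
def unitIntervalEigenvalue (p : ℝ) : ℝ :=
  fundamentalEigenvalue (Set.Ioo (0 : ℝ) 1) {0} p

end

/-!
The domain is sliced by the lines parallel to `e_i`, and the one-dimensional inequality is applied
on every segment in which such a line meets `Ω`. A segment `(a, b)` has length at most the width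
`L`. If its upper end `b` is a Dirichlet point, a test function vanishes near `b`, and the
definition of the eigenvalue of the unit interval, rescaled to `(a, b)` with `b` as Dirichlet end,
bounds `μ * ∫ |ζ| ^ p` by `L ^ p * ∫ |∂_i ζ| ^ p` over the segment
(`unitIntervalEigenvalue_mul_integral_Ioo_le`). Summing over the segments of a line
(`unitIntervalEigenvalue_mul_lintegral_le`), using `|∂_i ζ| ≤ |∇ζ|` and integrating over all lines
by Tonelli's theorem gives the bound for `Ω`.

It remains to see that on almost every line the upper ends of the segments are Dirichlet points
(`ae_forall_slicing_notMem_upperEnds`). Let `b` be an upper end which is a Neumann point. The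
points without a normal, or with a normal such that `ν_i > 0`, form a null set for the
`(d - 1)`-dimensional Hausdorff measure, whose projection along `e_i` is null. At all other points,
`ν_i ≤ 0` by hypothesis, while `ν_i ≥ 0` since the segment lies in `Ω` just below `b`
(`fderiv_apply_nonneg_of_mem_upperEnds`). Thus `e_i` is tangent to the boundary at `b`, so that
`b` is a critical point of the projection of the `C¹` hypersurface along `e_i`, and by Sard's
theorem in equal dimensions the lines through such points form a null set
(`exists_nhds_measure_lines_through_tangent_points_eq_zero`,
`measure_lines_through_upperEnds_eq_zero`).
-/

/-! ### Level sets tangent to a direction -/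

open Topology in
/-- Let `K` be the set of points of a `C¹` hypersurface `{φ = 0}` at which `e` is tangent to it.
Locally, the union of the lines parallel to `e` through the points of `K` has measure zero: it is
contained in the image of the critical set of a differentiable self-map of the space. -/
theorem exists_nhds_measure_lines_through_tangent_points_eq_zero {E : Type*}
    [NormedAddCommGroup E] [NormedSpace ℝ E] [FiniteDimensional ℝ E] [MeasurableSpace E]
    [BorelSpace E] (μ : Measure E) [μ.IsAddHaarMeasure] {φ : E → ℝ} {y e : E}
    (hφ : ContDiffAt ℝ 1 φ y) (hy : fderiv ℝ φ y ≠ 0) (hye : fderiv ℝ φ y e = 0) :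
    ∃ V ∈ 𝓝 y, μ {z | ∃ t : ℝ, ∃ x ∈ V, φ x = 0 ∧ fderiv ℝ φ x e = 0 ∧ z = x + t • e} = 0 := by
  have : CompleteSpace E := FiniteDimensional.complete ℝ E
  set l := fderiv ℝ φ y with hl
  obtain ⟨w, hw⟩ : ∃ w, l w = 1 := by
    obtain ⟨v, hv⟩ : ∃ v, l v ≠ 0 := by
      by_contra! h
      exact hy (ContinuousLinearMap.ext h)
    exact ⟨(l v)⁻¹ • v, by simp [hv]⟩
  -- `Ψ` straightens the level sets of `φ`, since `l ∘ Ψ = φ`, and its derivative at `y` is `1`.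
  set Ψ : E → E := fun x => x + (φ x - l x) • w with hΨ
  have hΨC : ContDiffAt ℝ 1 Ψ y :=
    contDiffAt_id.add ((hφ.sub l.contDiff.contDiffAt).smul contDiffAt_const)
  have hΨd : ∀ x, DifferentiableAt ℝ φ x →
      HasFDerivAt Ψ (ContinuousLinearMap.id ℝ E + (fderiv ℝ φ x - l).smulRight w) x := fun x hx =>
    (hasFDerivAt_id x).add ((hx.hasFDerivAt.sub l.hasFDerivAt).smul_const w)
  have hdy : DifferentiableAt ℝ φ y := hφ.differentiableAt one_ne_zero
  have hΨy : HasFDerivAt Ψ ((ContinuousLinearEquiv.refl ℝ E : E ≃L[ℝ] E) : E →L[ℝ] E) y := by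
    convert hΨd y hdy using 1
    ext v
    simp [hl]
  set R := hΨC.toOpenPartialHomeomorph Ψ hΨy one_ne_zero with hR
  have hRy : y ∈ R.source := hΨC.mem_toOpenPartialHomeomorph_source hΨy one_ne_zero
  have hRC : ContDiffAt ℝ 1 R.symm (Ψ y) := hΨC.to_localInverse hΨy one_ne_zero
  have hev : ∀ᶠ x in 𝓝 y, x ∈ R.source ∧ DifferentiableAt ℝ φ x ∧
      DifferentiableAt ℝ R.symm (Ψ x) := by
    refine (Filter.Eventually.and (R.open_source.mem_nhds hRy) ?_)
    refine Filter.Eventually.and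
      ((hφ.eventually (by simp)).mono fun x hx => hx.differentiableAt one_ne_zero) ?_
    exact hΨC.continuousAt.eventually
      ((hRC.eventually (by simp)).mono fun x hx => hx.differentiableAt one_ne_zero)
  refine ⟨_, hev, ?_⟩
  set Φ : E → E := fun z => R.symm (z - l z • w) + l z • e with hΦ
  set Φ' : E → E →L[ℝ] E := fun z =>
    (fderiv ℝ R.symm (z - l z • w)).comp (ContinuousLinearMap.id ℝ E - l.smulRight w) +
      l.smulRight e with hΦ'
  set s : Set E := {z | ∃ t : ℝ, ∃ x, (x ∈ R.source ∧ DifferentiableAt ℝ φ x ∧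
      DifferentiableAt ℝ R.symm (Ψ x)) ∧ φ x = 0 ∧ fderiv ℝ φ x e = 0 ∧ z = Ψ x + t • w} with hs
  have hproj : ∀ x (t : ℝ), φ x = 0 →
      l (Ψ x + t • w) = t ∧ (Ψ x + t • w) - l (Ψ x + t • w) • w = Ψ x := by
    intro x t hx
    have : l (Ψ x + t • w) = t := by simp [hΨ, hw, hx]
    exact ⟨this, by rw [this]; simp⟩
  have hnull : μ (Φ '' s) = 0 := by
    refine addHaar_image_eq_zero_of_det_fderivWithin_eq_zero μ (f' := Φ') ?_ ?_
    · rintro z ⟨t, x, ⟨-, -, hx⟩, h0, -, rfl⟩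
      obtain ⟨h1, h2⟩ := hproj x t h0
      refine HasFDerivAt.hasFDerivWithinAt (HasFDerivAt.add ?_ (l.hasFDerivAt.smul_const e))
      refine HasFDerivAt.comp (g := R.symm) (f := fun z => z - l z • w) _ ?_
        ((hasFDerivAt_id _).sub (l.hasFDerivAt.smul_const w))
      rw [h2]
      exact hx.hasFDerivAt
    -- The kernel of the derivative contains `e - w`, because the derivative of `Ψ` fixes `e`.
    · rintro z ⟨t, x, ⟨hxs, hxφ, hx⟩, h0, he, rfl⟩
      obtain ⟨h1, h2⟩ := hproj x t h0
      have hcomp : (fderiv ℝ R.symm (Ψ x)).comp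
          (ContinuousLinearMap.id ℝ E + (fderiv ℝ φ x - l).smulRight w) =
          ContinuousLinearMap.id ℝ E := by
        refine (hx.hasFDerivAt.comp x (hΨd x hxφ)).unique ?_
        refine (hasFDerivAt_id x).congr_of_eventuallyEq ?_
        filter_upwards [R.open_source.mem_nhds hxs] with v hv
        exact R.left_inv hv
      have hRe : fderiv ℝ R.symm (Ψ x) e = e := by
        have := DFunLike.congr_fun hcomp e
        simpa [he, hye] using this
      have hker : Φ' (Ψ x + t • w) (e - w) = 0 := by
        simp only [hΦ', h2]
        simp [hye, hw, hRe]
      have hne : e - w ≠ 0 := by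
        intro h
        have := congrArg l h
        simp [hye, hw] at this
      by_contra hdet
      refine hdet (LinearMap.det_eq_zero_iff_ker_ne_bot.2 fun hbot => hne ?_)
      exact (Submodule.eq_bot_iff _).1 hbot _ (LinearMap.mem_ker.2 hker)
  refine measure_mono_null ?_ hnull
  rintro z ⟨t, x, hx, h0, he, rfl⟩
  refine ⟨Ψ x + t • w, ⟨t, x, hx, h0, he, rfl⟩, ?_⟩
  obtain ⟨h1, h2⟩ := hproj x t h0
  simp only [hΦ]
  rw [h2, h1, show R.symm (Ψ x) = x from R.left_inv hx.1]

/-! ### The one-dimensional inequality -/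

theorem bddBelow_rayleighQuotientP {E : Type*} [NormedAddCommGroup E] [InnerProductSpace ℝ E]
    [CompleteSpace E] [MeasureSpace E] (p : ℝ) (Ω D : Set E) :
    BddBelow {r : ℝ | ∃ ζ : E → ℝ, IsTestFunction D ζ ∧ (∃ x ∈ Ω, ζ x ≠ 0) ∧
      r = rayleighQuotientP p Ω ζ} := by
  refine ⟨0, ?_⟩
  rintro _ ⟨ζ, -, -, rfl⟩
  exact div_nonneg (integral_nonneg fun x => by positivity)
    (integral_nonneg fun x => by positivity)

theorem unitIntervalEigenvalue_nonneg (p : ℝ) : 0 ≤ unitIntervalEigenvalue p := by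
  refine Real.sInf_nonneg ?_
  rintro _ ⟨ζ, -, -, rfl⟩
  exact div_nonneg (integral_nonneg fun x => by positivity)
    (integral_nonneg fun x => by positivity)

theorem unitIntervalEigenvalue_mul_integral_le {p : ℝ} (hp : 0 < p) {f : ℝ → ℝ}
    (hf : IsTestFunction {0} f) :
    unitIntervalEigenvalue p * ∫ x in Set.Ioo (0 : ℝ) 1, |f x| ^ p ≤
      ∫ x in Set.Ioo (0 : ℝ) 1, |deriv f x| ^ p := by
  have hnum : ∫ x in Set.Ioo (0 : ℝ) 1, ‖gradient f x‖ ^ p =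
      ∫ x in Set.Ioo (0 : ℝ) 1, |deriv f x| ^ p := by
    simp only [gradient_eq_deriv', Real.norm_eq_abs]
  have hden : 0 ≤ ∫ x in Set.Ioo (0 : ℝ) 1, |f x| ^ p := integral_nonneg fun x => by positivity
  rcases hden.eq_or_lt with h0 | h0
  · rw [← h0, mul_zero]
    exact integral_nonneg fun x => by positivity
  by_cases hne : ∃ x ∈ Set.Ioo (0 : ℝ) 1, f x ≠ 0
  · rw [← le_div_iff₀ h0, ← hnum]
    exact csInf_le (bddBelow_rayleighQuotientP p _ _) ⟨f, hf, hne, rfl⟩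
  · push Not at hne
    refine absurd (setIntegral_eq_zero_of_forall_eq_zero fun x hx => ?_) h0.ne'
    rw [hne x hx, abs_zero, Real.zero_rpow hp.ne']

/-- The inequality on an interval of length at most `L`, for a function vanishing near the upper
end: it is the definition of the eigenvalue of the unit interval, applied after an affine
reparametrisation sending `b` to the Dirichlet end `0`. -/
theorem unitIntervalEigenvalue_mul_integral_Ioo_le {p : ℝ} (hp : 1 < p) {h : ℝ → ℝ}
    (hC : ContDiff ℝ ∞ h) (hcs : HasCompactSupport h) {a b L : ℝ} (hab : a < b) (hL : b - a ≤ L)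
    (hb : b ∉ tsupport h) :
    unitIntervalEigenvalue p * ∫ x in Set.Ioo a b, |h x| ^ p ≤
      L ^ p * ∫ x in Set.Ioo a b, |deriv h x| ^ p := by
  have hl : 0 < b - a := sub_pos.2 hab
  set l := b - a with hldef
  set σ : ℝ ≃ₜ ℝ := (Homeomorph.mulLeft₀ l hl.ne').trans (Homeomorph.subLeft b) with hσ
  have hσa : ∀ s, σ s = b - l * s := fun s => rfl
  have htest : IsTestFunction {0} (h ∘ σ) := by
    refine ⟨hC.comp (contDiff_const.sub (contDiff_const.mul contDiff_id)),
      hcs.comp_homeomorph σ, ?_⟩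
    rw [Set.subset_compl_singleton_iff, tsupport_comp_eq_preimage]
    simpa [hσa] using hb
  have hder : ∀ s, deriv (h ∘ σ) s = -l * deriv h (b - l * s) := by
    intro s
    have h1 : HasDerivAt (fun s => b - l * s) (-l) s := by
      simpa using ((hasDerivAt_id s).const_mul l).const_sub b
    have h2 : HasDerivAt h (deriv h (b - l * s)) (b - l * s) :=
      (hC.differentiable (by simp) _).hasDerivAt
    exact (h2.comp s h1).deriv.trans (mul_comm _ _)
  have hcv : ∀ F : ℝ → ℝ, ∫ s in Set.Ioo (0 : ℝ) 1, F (b - l * s) =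
      l⁻¹ * ∫ x in Set.Ioo a b, F x := by
    intro F
    rw [← integral_Ioc_eq_integral_Ioo, ← integral_Ioc_eq_integral_Ioo,
      ← intervalIntegral.integral_of_le zero_le_one, ← intervalIntegral.integral_of_le hab.le,
      intervalIntegral.integral_comp_sub_mul _ hl.ne']
    simp [hldef]
  have key := unitIntervalEigenvalue_mul_integral_le (zero_lt_one.trans hp) htest
  simp only [hder, Function.comp_apply, hσa, abs_mul, abs_neg, abs_of_pos hl] at key
  simp only [Real.mul_rpow hl.le (abs_nonneg _)] at key
  rw [integral_const_mul, hcv (fun x => |h x| ^ p), hcv (fun x => |deriv h x| ^ p)] at key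
  have hlp : l ^ p ≤ L ^ p := Real.rpow_le_rpow hl.le hL (by linarith)
  have hnn : 0 ≤ ∫ x in Set.Ioo a b, |deriv h x| ^ p := integral_nonneg fun x => by positivity
  refine le_trans ?_ (mul_le_mul_of_nonneg_right hlp hnn)
  have hli : 0 < l⁻¹ := inv_pos.2 hl
  refine le_of_mul_le_mul_left ?_ hli
  linarith

open Set in
/-- The inequality on a bounded open subset of the line, obtained by summing the inequalities on its
countably many components. The Dirichlet condition is that `h` vanishes near the upper end `b` of
each component. -/
theorem unitIntervalEigenvalue_mul_lintegral_le {p : ℝ} (hp : 1 < p) {h : ℝ → ℝ}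
    (hC : ContDiff ℝ ∞ h) (hcs : HasCompactSupport h) {O : Set ℝ} (hO : IsOpen O)
    (hOb : Bornology.IsBounded O) {L : ℝ} (hL : ∀ s ∈ O, ∀ t ∈ O, t - s ≤ L)
    (hend : ∀ a b, a < b → Ioo a b ⊆ O → b ∉ O → b ∉ tsupport h) :
    ENNReal.ofReal (unitIntervalEigenvalue p) * ∫⁻ x in O, ENNReal.ofReal (|h x| ^ p) ≤
      ENNReal.ofReal (L ^ p) * ∫⁻ x in O, ENNReal.ofReal (|deriv h x| ^ p) := by
  have hp0 : 0 < p := by linarith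
  set C : Set (Set ℝ) := (fun t => connectedComponentIn O t) '' O with hCdef
  have hopen : ∀ s ∈ C, IsOpen s := by
    rintro _ ⟨t, -, rfl⟩
    exact hO.connectedComponentIn
  have hdisj : C.PairwiseDisjoint id := by
    rintro _ ⟨t, ht, rfl⟩ _ ⟨u, hu, rfl⟩ hne
    refine Set.disjoint_left.2 fun x hx hx' => hne ?_
    exact (connectedComponentIn_eq hx).trans (connectedComponentIn_eq hx').symm
  have hcount : C.Countable := hdisj.countable_of_isOpen hopen (by
    rintro _ ⟨t, ht, rfl⟩
    exact ⟨t, mem_connectedComponentIn ht⟩)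
  have hunion : O = ⋃ s ∈ C, id s := by
    ext t
    simp only [mem_iUnion, id, hCdef, mem_image, exists_prop]
    constructor
    · exact fun ht => ⟨_, ⟨t, ht, rfl⟩, mem_connectedComponentIn ht⟩
    · rintro ⟨_, ⟨u, -, rfl⟩, ht⟩
      exact connectedComponentIn_subset O u ht
  have hsplit : ∀ F : ℝ → ENNReal, ∫⁻ x in O, F x = ∑' s : C, ∫⁻ x in (s : Set ℝ), F x := by
    intro F
    conv_lhs => rw [hunion]
    exact lintegral_biUnion hcount (fun s hs => (hopen s hs).measurableSet) hdisj F
  rw [hsplit, hsplit, ← ENNReal.tsum_mul_left, ← ENNReal.tsum_mul_left]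
  refine ENNReal.tsum_le_tsum ?_
  rintro ⟨_, t, ht, rfl⟩
  have hcO : connectedComponentIn O t ⊆ O := connectedComponentIn_subset O t
  have hconn : IsConnected (connectedComponentIn O t) :=
    isConnected_connectedComponentIn_iff.2 ht
  have hbb := (hOb.subset hcO).bddBelow
  have hba := (hOb.subset hcO).bddAbove
  have hIoo : connectedComponentIn O t =
      Ioo (sInf (connectedComponentIn O t)) (sSup (connectedComponentIn O t)) := by
    refine Subset.antisymm ?_ (hconn.Ioo_csInf_csSup_subset hbb hba)
    rw [← interior_Icc]
    exact interior_maximal (subset_Icc_csInf_csSup hbb hba) hO.connectedComponentIn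
  set a := sInf (connectedComponentIn O t)
  set b := sSup (connectedComponentIn O t)
  have htab : t ∈ Ioo a b := hIoo ▸ mem_connectedComponentIn ht
  have hab : a < b := htab.1.trans htab.2
  have hbO : b ∉ O := by
    intro hb
    have hpre : IsPreconnected (insert b (Ioo a b)) := by
      rw [insert_eq, union_comm, Ioo_union_right hab]
      exact isPreconnected_Ioc
    have hsub : insert b (Ioo a b) ⊆ connectedComponentIn O t :=
      hpre.subset_connectedComponentIn (mem_insert_of_mem _ htab)
        (insert_subset hb (hIoo ▸ hcO))
    have := hsub (mem_insert _ _)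
    rw [hIoo] at this
    exact lt_irrefl _ this.2
  have hL0 : 0 ≤ L := by simpa using hL t ht t ht
  have hlen : b - a ≤ L := by
    by_contra! hlt
    have h1 := hL (a + (b - a - L) / 3) (hcO (hIoo ▸ ⟨by linarith, by linarith⟩))
      (b - (b - a - L) / 3) (hcO (hIoo ▸ ⟨by linarith, by linarith⟩))
    linarith
  have key := unitIntervalEigenvalue_mul_integral_Ioo_le hp hC hcs hab hlen
    (hend a b hab (hIoo ▸ hcO) hbO)
  have hi1 : Integrable (fun x => |h x| ^ p) (volume.restrict (Ioo a b)) :=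
    ((hC.continuous.abs.rpow_const fun _ => Or.inr hp0.le).integrableOn_Icc).mono_set
      Ioo_subset_Icc_self
  have hi2 : Integrable (fun x => |deriv h x| ^ p) (volume.restrict (Ioo a b)) :=
    ((hC.continuous_deriv (by simp)).abs.rpow_const fun _ =>
      Or.inr hp0.le).integrableOn_Icc.mono_set Ioo_subset_Icc_self
  have hLp : 0 ≤ L ^ p := Real.rpow_nonneg hL0 _
  change _ * ∫⁻ x in connectedComponentIn O t, _ ≤ _ * ∫⁻ x in connectedComponentIn O t, _
  rw [hIoo, ← ofReal_integral_eq_lintegral_ofReal hi1 (ae_of_all _ fun x => by positivity),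
    ← ofReal_integral_eq_lintegral_ofReal hi2 (ae_of_all _ fun x => by positivity),
    ← ENNReal.ofReal_mul (unitIntervalEigenvalue_nonneg p), ← ENNReal.ofReal_mul hLp]
  exact ENNReal.ofReal_le_ofReal key

/-! ### Neumann points at the upper end of a segment -/

/-- The points of `frontier Ω` which are the upper end of a segment in `Ω` of direction `e`. -/
def upperEnds {E : Type*} [NormedAddCommGroup E] [InnerProductSpace ℝ E] (Ω : Set E) (e : E) :
    Set E :=
  {y | y ∈ frontier Ω ∧ ∃ ε > (0 : ℝ), ∀ t ∈ Set.Ioo 0 ε, y - t • e ∈ Ω}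

theorem norm_gradient_eq_norm_fderiv {E : Type*} [NormedAddCommGroup E] [InnerProductSpace ℝ E]
    [CompleteSpace E] (φ : E → ℝ) (x : E) : ‖gradient φ x‖ = ‖fderiv ℝ φ x‖ := by
  rw [← toDual_gradient, LinearIsometryEquiv.norm_map]

theorem eq_zero_of_mem_frontier {X : Type*} [TopologicalSpace X] {Ω U : Set X} {φ : X → ℝ} {y : X}
    (hΩ : IsOpen Ω) (hU : IsOpen U) (hφ : ContinuousOn φ U)
    (hΩU : Ω ∩ U = {x ∈ U | φ x < 0}) (hyU : y ∈ U) (hy : y ∈ frontier Ω) :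
    φ y = 0 := by
  refine le_antisymm ?_ ?_
  · by_contra! hpos
    have hev : ∀ᶠ x in nhds y, x ∈ U ∧ 0 < φ x :=
      Filter.Eventually.and (hU.mem_nhds hyU)
        ((hφ.continuousAt (hU.mem_nhds hyU)).eventually (lt_mem_nhds hpos))
    obtain ⟨x, ⟨hxU, hx⟩, hxΩ⟩ := mem_closure_iff_nhds.1 hy.1 _ hev
    have : x ∈ {x ∈ U | φ x < 0} := hΩU ▸ ⟨hxΩ, hxU⟩
    exact lt_asymm hx this.2
  · by_contra! hneg
    have : y ∈ Ω ∩ U := hΩU ▸ ⟨hyU, hneg⟩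
    exact hy.2 (hΩ.interior_eq.symm ▸ this.1)

section

variable {E : Type*} [NormedAddCommGroup E] [InnerProductSpace ℝ E] {Ω U : Set E} {φ : E → ℝ}
  {y e : E}

theorem fderiv_apply_nonneg_of_mem_upperEnds (hΩ : IsOpen Ω) (hU : IsOpen U)
    (hφ : ContDiffOn ℝ 1 φ U) (hΩU : Ω ∩ U = {x ∈ U | φ x < 0}) (hyU : y ∈ U)
    (hy : y ∈ upperEnds Ω e) : 0 ≤ fderiv ℝ φ y e := by
  have h0 := eq_zero_of_mem_frontier hΩ hU hφ.continuousOn hΩU hyU hy.1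
  obtain ⟨-, ε, hε, hseg⟩ := hy
  have hd : HasDerivAt (fun t : ℝ => φ (y - t • e)) (-(fderiv ℝ φ y e)) 0 := by
    have h1 : HasDerivAt (fun t : ℝ => y - t • e) (-e) 0 := by
      simpa using ((hasDerivAt_id (0 : ℝ)).smul_const e).const_sub y
    have h2 : HasFDerivAt φ (fderiv ℝ φ y) (y - (0 : ℝ) • e) := by
      simpa using
        ((hφ.contDiffAt (hU.mem_nhds hyU)).differentiableAt one_ne_zero).hasFDerivAt
    exact (h2.comp_hasDerivAt (0 : ℝ) h1).congr_deriv (map_neg _ _)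
  have hs := (hasDerivAt_iff_tendsto_slope.1 hd).mono_left
    (nhdsWithin_mono (0 : ℝ) (fun t (ht : t ∈ Set.Ioi (0 : ℝ)) => ne_of_gt ht))
  have hUev : ∀ᶠ t in nhdsWithin (0 : ℝ) (Set.Ioi 0), y - t • e ∈ U := by
    refine Filter.Eventually.filter_mono nhdsWithin_le_nhds ?_
    have hc : ContinuousAt (fun t : ℝ => y - t • e) 0 := by fun_prop
    exact hc.eventually (by simpa using hU.mem_nhds hyU)
  have hle : -(fderiv ℝ φ y e) ≤ 0 := by
    refine le_of_tendsto hs ?_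
    filter_upwards [hUev, Ioo_mem_nhdsGT hε] with t htU ht
    have hneg : y - t • e ∈ {x ∈ U | φ x < 0} := hΩU ▸ ⟨hseg t ht, htU⟩
    rw [slope_def_field]
    refine div_nonpos_of_nonpos_of_nonneg ?_ (by linarith [ht.1])
    simpa [h0] using hneg.2.le
  linarith

open Topology in
/-- At an upper end of a segment the outward normal satisfies `⟪ν, e⟫ ≥ 0`. So where `⟪ν, e⟫ ≤ 0`
as well, the boundary is tangent to `e`, and the lines through such points form a null set. -/
theorem measure_lines_through_upperEnds_eq_zero [CompleteSpace E] [FiniteDimensional ℝ E]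
    [MeasurableSpace E] [BorelSpace E] (μ : Measure E) [μ.IsAddHaarMeasure] (hΩ : IsOpen Ω) (e : E) :
    μ {z | ∃ t : ℝ, ∃ y ∈ {y | y ∈ upperEnds Ω e ∧ (∃ ν, IsOutwardUnitNormal Ω y ν) ∧
      ∀ ν, IsOutwardUnitNormal Ω y ν → inner ℝ ν e ≤ 0}, z = y + t • e} = 0 := by
  set T := {y | y ∈ upperEnds Ω e ∧ (∃ ν, IsOutwardUnitNormal Ω y ν) ∧
      ∀ ν, IsOutwardUnitNormal Ω y ν → inner ℝ ν e ≤ 0} with hT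
  have hloc : ∀ y ∈ T, ∃ V ∈ 𝓝 y, μ {z | ∃ t : ℝ, ∃ x ∈ T ∩ V, z = x + t • e} = 0 := by
    intro y hy
    obtain ⟨-, ⟨_, -, -, φ, U, hU, hyU, hφ, hΩU, hg, -⟩, -⟩ := id hy
    have key : ∀ x ∈ T, x ∈ U → gradient φ x ≠ 0 → φ x = 0 ∧ fderiv ℝ φ x e = 0 := by
      rintro x ⟨hx, -, hxν⟩ hxU hgx
      refine ⟨eq_zero_of_mem_frontier hΩ hU hφ.continuousOn hΩU hxU hx.1, le_antisymm ?_
        (fderiv_apply_nonneg_of_mem_upperEnds hΩ hU hφ hΩU hxU hx)⟩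
      have hn : ‖gradient φ x‖ ≠ 0 := norm_ne_zero_iff.2 hgx
      have := hxν (‖gradient φ x‖⁻¹ • gradient φ x) ⟨hx.1, by simp [norm_smul, hn], φ, U, hU, hxU,
        hφ, hΩU, hgx, by rw [smul_smul, mul_inv_cancel₀ hn, one_smul]⟩
      rw [real_inner_smul_left, inner_gradient_left] at this
      by_contra! hpos
      exact absurd (mul_pos (inv_pos.2 (norm_pos_iff.2 hgx)) hpos) (not_lt.2 this)
    have hfg : ∀ x, fderiv ℝ φ x ≠ 0 ↔ gradient φ x ≠ 0 := fun x => by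
      rw [← norm_ne_zero_iff, ← norm_gradient_eq_norm_fderiv, norm_ne_zero_iff]
    have hφy := hφ.contDiffAt (hU.mem_nhds hyU)
    obtain ⟨V, hV, hnull⟩ := exists_nhds_measure_lines_through_tangent_points_eq_zero μ hφy
      ((hfg y).2 hg) (key y hy hyU hg).2
    have hne : ∀ᶠ x in 𝓝 y, fderiv ℝ φ x ≠ 0 :=
      (hφy.fderiv_right (m := 0) (by norm_num)).continuousAt.eventually_ne ((hfg y).2 hg)
    refine ⟨V ∩ (U ∩ {x | fderiv ℝ φ x ≠ 0}), Filter.inter_mem hV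
      (Filter.inter_mem (hU.mem_nhds hyU) hne), measure_mono_null ?_ hnull⟩
    rintro z ⟨t, x, ⟨hxT, hxV, hxU, hxg⟩, rfl⟩
    obtain ⟨h1, h2⟩ := key x hxT hxU ((hfg x).1 hxg)
    exact ⟨t, x, hxV, h1, h2, rfl⟩
  choose! V hV hnull using hloc
  obtain ⟨c, hcT, hcc, hcov⟩ := TopologicalSpace.countable_cover_nhdsWithin
    (fun y hy => mem_nhdsWithin_of_mem_nhds (hV y hy))
  refine measure_mono_null ?_ ((measure_biUnion_null_iff hcc).2 fun y hy => hnull y (hcT hy))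
  rintro z ⟨t, x, hx, rfl⟩
  obtain ⟨y, hyc, hxy⟩ := Set.mem_iUnion₂.1 (hcov hx)
  exact Set.mem_iUnion₂.2 ⟨y, hyc, t, x, ⟨hx, hxy⟩, rfl⟩

end

/-! ### Slicing by lines parallel to a coordinate axis -/

/-- The coordinates on `ℝ^(n+1)` given by the `i`-th coordinate and the remaining `n` ones. -/
noncomputable def slicing {n : ℕ} (i : Fin (n + 1)) :
    ℝ × (Fin n → ℝ) ≃ᵐ EuclideanSpace ℝ (Fin (n + 1)) :=
  (MeasurableEquiv.piFinSuccAbove (fun _ => ℝ) i).symm.trans (MeasurableEquiv.toLp 2 _)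

section

variable {n : ℕ} (i : Fin (n + 1))

theorem measurePreserving_slicing : MeasurePreserving (slicing i) := by
  exact MeasurePreserving.comp (g := WithLp.toLp 2) (PiLp.volume_preserving_toLp (Fin (n + 1)))
    (MeasurePreserving.symm _ (volume_preserving_piFinSuccAbove (fun _ => ℝ) i))

theorem slicing_apply_same (t : ℝ) (x : Fin n → ℝ) : slicing i (t, x) i = t := by
  simp [slicing]

theorem slicing_apply_succAbove (t : ℝ) (x : Fin n → ℝ) (j : Fin n) :
    slicing i (t, x) (i.succAbove j) = x j := by
  simp [slicing]

theorem slicing_add (s t : ℝ) (x : Fin n → ℝ) :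
    slicing i (s + t, x) = slicing i (s, x) + t • EuclideanSpace.single i (1 : ℝ) := by
  ext k
  rcases Fin.eq_self_or_eq_succAbove i k with rfl | ⟨j, rfl⟩
  · simp [slicing_apply_same]
  · simp [slicing_apply_succAbove]

theorem slicing_eq (t : ℝ) (x : Fin n → ℝ) :
    slicing i (t, x) = slicing i (0, x) + t • EuclideanSpace.single i (1 : ℝ) := by
  rw [← slicing_add, zero_add]

theorem setLIntegral_eq_lintegral_slicing {Ω : Set (EuclideanSpace ℝ (Fin (n + 1)))}
    (hΩ : MeasurableSet Ω) {F : EuclideanSpace ℝ (Fin (n + 1)) → ENNReal} (hF : Measurable F) :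
    ∫⁻ x in Ω, F x = ∫⁻ x : Fin n → ℝ, ∫⁻ t in {t | slicing i (t, x) ∈ Ω}, F (slicing i (t, x)) := by
  have hm := (hF.indicator hΩ).comp (slicing i).measurable
  rw [← lintegral_indicator hΩ,
    ← (measurePreserving_slicing i).lintegral_comp (hF.indicator hΩ)]
  refine (lintegral_prod_symm' _ hm).trans (lintegral_congr fun x => ?_)
  have hms : MeasurableSet {t | slicing i (t, x) ∈ Ω} :=
    (slicing i).measurable.comp (measurable_id.prodMk measurable_const) hΩ
  rw [← lintegral_indicator hms]
  rfl

/-- A set which is null for the `n`-dimensional Hausdorff measure is missed by almost every line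
parallel to the `i`-th axis, as the projection along that axis is Lipschitz. -/
theorem ae_forall_slicing_notMem_of_hausdorffMeasure_eq_zero
    {Z : Set (EuclideanSpace ℝ (Fin (n + 1)))} (hZ : Measure.hausdorffMeasure (n : ℝ) Z = 0) :
    ∀ᵐ x : Fin n → ℝ, ∀ t : ℝ, slicing i (t, x) ∉ Z := by
  set π : EuclideanSpace ℝ (Fin (n + 1)) → (Fin n → ℝ) := fun y j => y (i.succAbove j)
  have hπ : LipschitzWith 1 π := by
    refine LipschitzWith.of_dist_le_mul fun y z => ?_
    rw [NNReal.coe_one, one_mul, dist_pi_le_iff dist_nonneg]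
    intro j
    rw [dist_eq_norm, dist_eq_norm]
    exact PiLp.norm_apply_le (y - z) (i.succAbove j)
  have hnull : volume (π '' Z) = 0 := by
    rw [← hausdorffMeasure_pi_real, Fintype.card_fin]
    refine le_antisymm ((hπ.hausdorffMeasure_image_le n.cast_nonneg Z).trans ?_) zero_le
    simp [hZ]
  filter_upwards [measure_eq_zero_iff_ae_notMem.1 hnull] with x hx t ht
  exact hx ⟨_, ht, funext fun j => slicing_apply_succAbove i t x j⟩

theorem ae_forall_slicing_notMem_of_lines {T : Set (EuclideanSpace ℝ (Fin (n + 1)))}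
    (hT : volume {z | ∃ t : ℝ, ∃ y ∈ T, z = y + t • EuclideanSpace.single i (1 : ℝ)} = 0) :
    ∀ᵐ x : Fin n → ℝ, ∀ t : ℝ, slicing i (t, x) ∉ T := by
  have h1 := (measurePreserving_slicing i).quasiMeasurePreserving.ae
    (measure_eq_zero_iff_ae_notMem.1 hT)
  have h2 := Measure.ae_ae_of_ae_prod (Measure.measurePreserving_swap.quasiMeasurePreserving.ae h1)
  filter_upwards [h2] with x hx t ht
  -- Membership in the union of lines does not depend on the point chosen on the line.
  obtain ⟨s, hs⟩ := hx.exists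
  refine hs ⟨s - t, _, ht, ?_⟩
  rw [← slicing_add, add_sub_cancel]
  rfl

/-- If the outward normal satisfies `ν i ≤ 0` almost everywhere on `N`, then on almost every line
parallel to the `i`-th axis, no upper end of a segment in `Ω` belongs to `N`. -/
theorem ae_forall_slicing_notMem_upperEnds {Ω N : Set (EuclideanSpace ℝ (Fin (n + 1)))}
    (hΩ : IsOpen Ω)
    (hC1 : ∀ᵐ y ∂(Measure.hausdorffMeasure (n : ℝ)), y ∈ N → ∃ ν, IsOutwardUnitNormal Ω y ν)
    (hnormal : ∀ᵐ y ∂(Measure.hausdorffMeasure (n : ℝ)),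
      y ∈ N → ∀ ν : EuclideanSpace ℝ (Fin (n + 1)), IsOutwardUnitNormal Ω y ν → ν i ≤ 0) :
    ∀ᵐ x : Fin n → ℝ, ∀ t : ℝ,
      slicing i (t, x) ∈ upperEnds Ω (EuclideanSpace.single i 1) → slicing i (t, x) ∉ N := by
  have hZ := ae_iff.1 (hC1.and hnormal)
  filter_upwards [ae_forall_slicing_notMem_of_hausdorffMeasure_eq_zero i hZ,
    ae_forall_slicing_notMem_of_lines i (measure_lines_through_upperEnds_eq_zero volume hΩ
      (EuclideanSpace.single i (1 : ℝ)))] with x h1 h2 t hup hN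
  obtain ⟨h3, h4⟩ := not_not.1 (h1 t)
  refine h2 t ⟨hup, h3 hN, fun ν hν => ?_⟩
  simpa [EuclideanSpace.inner_single_right] using h4 hN ν hν

end

/-! ### The inequality between the integrals over the domain -/

section

variable {n : ℕ} {i : Fin (n + 1)} {Ω : Set (EuclideanSpace ℝ (Fin (n + 1)))}

theorem isBounded_image_apply (hb : Bornology.IsBounded Ω) :
    Bornology.IsBounded ((fun x : EuclideanSpace ℝ (Fin (n + 1)) => x i) '' Ω) :=
  (EuclideanSpace.proj (𝕜 := ℝ) i).lipschitz.isBounded_image hb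

theorem apply_sub_apply_le_widthAlong (hb : Bornology.IsBounded Ω)
    {x y : EuclideanSpace ℝ (Fin (n + 1))} (hx : x ∈ Ω) (hy : y ∈ Ω) :
    y i - x i ≤ widthAlong i Ω :=
  sub_le_sub (le_csSup (isBounded_image_apply hb).bddAbove ⟨y, hy, rfl⟩)
    (csInf_le (isBounded_image_apply hb).bddBelow ⟨x, hx, rfl⟩)

theorem isometry_slicing (i : Fin (n + 1)) (x : Fin n → ℝ) :
    Isometry fun t : ℝ => slicing i (t, x) := by
  refine Isometry.of_dist_eq fun s t => ?_
  rw [slicing_eq i s, slicing_eq i t, dist_add_left, dist_eq_norm, ← sub_smul, norm_smul]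
  simp [dist_eq_norm]

theorem widthAlong_pos (hΩ : IsOpen Ω) (hne : Ω.Nonempty) (hb : Bornology.IsBounded Ω) :
    0 < widthAlong i Ω := by
  obtain ⟨y, hy⟩ := hne
  obtain ⟨⟨t, x⟩, rfl⟩ := (slicing i).surjective y
  have hev : ∀ᶠ s in nhds t, slicing i (s, x) ∈ Ω :=
    (isometry_slicing i x).continuous.continuousAt.eventually (hΩ.mem_nhds hy)
  obtain ⟨s, hs, hts⟩ := ((hev.filter_mono nhdsWithin_le_nhds).and
    (self_mem_nhdsWithin : Set.Ioi t ∈ nhdsWithin t (Set.Ioi t))).exists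
  have := apply_sub_apply_le_widthAlong (i := i) hb hy hs
  rw [slicing_apply_same, slicing_apply_same] at this
  exact (sub_pos.2 hts).trans_le this

/-- The inequality on one line parallel to the `i`-th axis, provided that the upper ends of the
segments in which the line meets `Ω` are Dirichlet points. -/
theorem unitIntervalEigenvalue_mul_lintegral_slicing_le {p : ℝ} (hp : 1 < p) (hΩ : IsOpen Ω)
    (hb : Bornology.IsBounded Ω) {D : Set (EuclideanSpace ℝ (Fin (n + 1)))}
    {ζ : EuclideanSpace ℝ (Fin (n + 1)) → ℝ} (hζ : IsTestFunction D ζ) (x : Fin n → ℝ)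
    (hx : ∀ t : ℝ, slicing i (t, x) ∈ upperEnds Ω (EuclideanSpace.single i 1) →
      slicing i (t, x) ∈ D) :
    ENNReal.ofReal (unitIntervalEigenvalue p) *
        ∫⁻ t in {t | slicing i (t, x) ∈ Ω}, ENNReal.ofReal (|ζ (slicing i (t, x))| ^ p) ≤
      ENNReal.ofReal (widthAlong i Ω ^ p) *
        ∫⁻ t in {t | slicing i (t, x) ∈ Ω},
          ENNReal.ofReal (‖gradient ζ (slicing i (t, x))‖ ^ p) := by
  obtain ⟨hC, hcs, hsupp⟩ := hζ
  have hiso := isometry_slicing i x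
  have hO : IsOpen {t | slicing i (t, x) ∈ Ω} := hΩ.preimage hiso.continuous
  have hd : ∀ t, HasDerivAt (fun t => slicing i (t, x)) (EuclideanSpace.single i (1 : ℝ)) t := by
    intro t
    rw [funext fun t => slicing_eq i t x]
    simpa using ((hasDerivAt_id t).smul_const (EuclideanSpace.single i (1 : ℝ))).const_add
      (slicing i (0, x))
  have hsm : ContDiff ℝ ∞ fun t => slicing i (t, x) := by
    rw [funext fun t => slicing_eq i t x]
    fun_prop
  have hline := unitIntervalEigenvalue_mul_lintegral_le hp (hC.comp hsm)
    (hcs.comp_isClosedEmbedding hiso.isClosedEmbedding) hO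
    (L := widthAlong i Ω) ?_ ?_ ?_
  · refine hline.trans (mul_le_mul_right (lintegral_mono fun t => ENNReal.ofReal_le_ofReal ?_) _)
    refine Real.rpow_le_rpow (abs_nonneg _) ?_ (by linarith)
    have hζd := ((hC.differentiable (by simp)) (slicing i (t, x))).hasFDerivAt
    rw [(hζd.comp_hasDerivAt t (hd t)).deriv, norm_gradient_eq_norm_fderiv, ← Real.norm_eq_abs]
    exact (ContinuousLinearMap.le_opNorm _ _).trans_eq (by simp)
  · refine (isBounded_image_apply (i := i) hb).subset fun t ht => ?_
    exact ⟨_, ht, slicing_apply_same i t x⟩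
  · intro s hs t ht
    simpa [slicing_apply_same] using apply_sub_apply_le_widthAlong (i := i) hb hs ht
  · intro a b hab hsub hbO hmem
    have hup : slicing i (b, x) ∈ upperEnds Ω (EuclideanSpace.single i 1) := by
      refine ⟨⟨?_, fun h => hbO (show slicing i (b, x) ∈ Ω from interior_subset h)⟩,
        b - a, sub_pos.2 hab, fun t ht => ?_⟩
      · have hbcl : b ∈ closure (Set.Ioo a b) := by
          rw [closure_Ioo hab.ne]
          exact Set.right_mem_Icc.2 hab.le
        exact map_mem_closure (f := fun t => slicing i (t, x)) hiso.continuous hbcl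
          fun t ht => hsub ht
      · rw [sub_eq_add_neg, ← neg_smul, ← slicing_add]
        exact hsub ⟨by linarith [ht.2], by linarith [ht.1]⟩
    exact hsupp (tsupport_comp_subset_preimage ζ hiso.continuous hmem) (hx b hup)

theorem integrable_norm_rpow {E : Type*} [NormedAddCommGroup E] [MeasurableSpace E] [BorelSpace E]
    {μ : Measure E} [IsFiniteMeasureOnCompacts μ] {F : Type*} [NormedAddCommGroup F] {f : E → F}
    {p : ℝ} (hp : 0 < p) (hf : Continuous f) (hcs : HasCompactSupport f) :
    Integrable (fun x => ‖f x‖ ^ p) μ := by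
  refine (hf.norm.rpow_const fun _ => Or.inr hp.le).integrable_of_hasCompactSupport ?_
  exact hcs.comp_left (g := fun y => ‖y‖ ^ p) (by simp [hp.ne'])

theorem unitIntervalEigenvalue_mul_setIntegral_le {p : ℝ} (hp : 1 < p) (hΩ : IsOpen Ω)
    (hb : Bornology.IsBounded Ω) {D : Set (EuclideanSpace ℝ (Fin (n + 1)))}
    {ζ : EuclideanSpace ℝ (Fin (n + 1)) → ℝ} (hζ : IsTestFunction D ζ)
    (hL : 0 ≤ widthAlong i Ω)
    (hae : ∀ᵐ x : Fin n → ℝ, ∀ t : ℝ, slicing i (t, x) ∈ upperEnds Ω (EuclideanSpace.single i 1) →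
      slicing i (t, x) ∈ D) :
    unitIntervalEigenvalue p * ∫ x in Ω, |ζ x| ^ p ≤
      widthAlong i Ω ^ p * ∫ x in Ω, ‖gradient ζ x‖ ^ p := by
  have hp0 : 0 < p := by linarith
  have hgc : Continuous (gradient ζ) :=
    (InnerProductSpace.toDual ℝ _).symm.continuous.comp (hζ.1.continuous_fderiv (by simp))
  have hgcs : HasCompactSupport (gradient ζ) :=
    (hζ.2.1.fderiv ℝ).comp_left (map_zero (InnerProductSpace.toDual ℝ _).symm)
  have hi1 : Integrable (fun x => |ζ x| ^ p) (volume.restrict Ω) :=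
    (integrable_norm_rpow hp0 hζ.1.continuous hζ.2.1).restrict
  have hi2 : Integrable (fun x => ‖gradient ζ x‖ ^ p) (volume.restrict Ω) :=
    (integrable_norm_rpow hp0 hgc hgcs).restrict
  have hn2 : 0 ≤ ∫ x in Ω, ‖gradient ζ x‖ ^ p := integral_nonneg fun x => by positivity
  rw [← ENNReal.ofReal_le_ofReal_iff (mul_nonneg (Real.rpow_nonneg hL _) hn2),
    ENNReal.ofReal_mul (unitIntervalEigenvalue_nonneg p),
    ENNReal.ofReal_mul (Real.rpow_nonneg hL _),
    ofReal_integral_eq_lintegral_ofReal hi1 (ae_of_all _ fun x => by positivity),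
    ofReal_integral_eq_lintegral_ofReal hi2 (ae_of_all _ fun x => by positivity),
    setLIntegral_eq_lintegral_slicing i hΩ.measurableSet (
      (hζ.1.continuous.abs.rpow_const fun _ => Or.inr hp0.le).measurable.ennreal_ofReal),
    setLIntegral_eq_lintegral_slicing i hΩ.measurableSet (
      (hgc.norm.rpow_const fun _ => Or.inr hp0.le).measurable.ennreal_ofReal),
    ← lintegral_const_mul' _ _ ENNReal.ofReal_ne_top,
    ← lintegral_const_mul' _ _ ENNReal.ofReal_ne_top]
  refine lintegral_mono_ae ?_
  filter_upwards [hae] with x hx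
  exact unitIntervalEigenvalue_mul_lintegral_slicing_le hp hΩ hb hζ x hx

theorem setIntegral_abs_rpow_pos {p : ℝ} (hp : 0 < p) (hΩ : IsOpen Ω)
    {ζ : EuclideanSpace ℝ (Fin (n + 1)) → ℝ} (hζ : Continuous ζ) (hcs : HasCompactSupport ζ)
    (hne : ∃ x ∈ Ω, ζ x ≠ 0) : 0 < ∫ x in Ω, |ζ x| ^ p := by
  obtain ⟨x, hx, hζx⟩ := hne
  have hint : Integrable (fun x => |ζ x| ^ p) := integrable_norm_rpow hp hζ hcs
  rw [setIntegral_pos_iff_support_of_nonneg_ae (ae_of_all _ fun x => by positivity)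
    hint.integrableOn]
  refine (((hζ.isOpen_preimage _ isOpen_compl_singleton).inter hΩ).measure_pos volume
    ⟨x, hζx, hx⟩).trans_le (measure_mono (Set.inter_subset_inter_left _ fun y hy => ?_))
  exact (Real.rpow_pos_of_pos (abs_pos.2 hy) _).ne'

theorem exists_isTestFunction_ne_zero (hΩ : IsOpen Ω) (hne : Ω.Nonempty)
    {D : Set (EuclideanSpace ℝ (Fin (n + 1)))} (hD : D ⊆ frontier Ω) :
    ∃ ζ, IsTestFunction D ζ ∧ ∃ x ∈ Ω, ζ x ≠ 0 := by
  obtain ⟨x, hx⟩ := hne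
  obtain ⟨ζ, hsupp, hcs, hC, -, h1⟩ :=
    exists_contDiff_tsupport_subset (n := ⊤) (hΩ.mem_nhds hx)
  refine ⟨ζ, ⟨hC, hcs, fun y hy hyD => ?_⟩, x, hx, by simp [h1]⟩
  exact (hD hyD).2 (hΩ.interior_eq.symm ▸ hsupp hy)

end

theorem mainTheorem6 (d : ℕ) (i : Fin d) (p : ℝ) (hp : 1 < p)
    (Ω D : Set (EuclideanSpace ℝ (Fin d))) (hΩ : IsRegularDomain Ω D)
    (hgraph : IsGraphOverHyperplane i (frontier Ω \ D))
    (hnormal : ∀ᵐ y ∂(Measure.hausdorffMeasure ((d : ℝ) - 1)),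
      y ∈ frontier Ω \ D → ∀ ν : EuclideanSpace ℝ (Fin d), IsOutwardUnitNormal Ω y ν → ν i ≤ 0) :
    unitIntervalEigenvalue p / widthAlong i Ω ^ p ≤ fundamentalEigenvalue Ω D p := by
  obtain _ | n := d
  · exact i.elim0
  have hC1 := hΩ.ae_C1
  rw [Nat.cast_add_one, add_sub_cancel_right] at hC1 hnormal
  have hL : 0 < widthAlong i Ω := widthAlong_pos hΩ.isOpen hΩ.isConnected.nonempty hΩ.isBounded
  have hae := ae_forall_slicing_notMem_upperEnds i hΩ.isOpen hC1 hnormal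
  obtain ⟨ζ₀, h₀, h₀'⟩ :=
    exists_isTestFunction_ne_zero hΩ.isOpen hΩ.isConnected.nonempty hΩ.subset_frontier
  refine le_csInf ⟨_, ζ₀, h₀, h₀', rfl⟩ ?_
  rintro _ ⟨ζ, hζ, hne, rfl⟩
  rw [rayleighQuotientP, div_le_div_iff₀ (Real.rpow_pos_of_pos hL p)
    (setIntegral_abs_rpow_pos (by linarith) hΩ.isOpen hζ.1.continuous hζ.2.1 hne),
    mul_comm (∫ x in Ω, _)]
  refine unitIntervalEigenvalue_mul_setIntegral_le hp hΩ.isOpen hΩ.isBounded hζ hL.le ?_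
  filter_upwards [hae] with x hx t ht
  by_contra hD
  exact hx t ht ⟨ht.1, hD⟩
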